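/- Let $n\ge 3$ be an integer and let $\omega\in\mathbb{C}$ be a root of unity of order exactly $n$ (a primitive $n$-th root of unity). Let $H$ be the Radford algebra over $\mathbb{C}$, that is, the associative unital $\mathbb{C}$-algebra generated by $g,x,y$ subject to the relations $$g^n=1,\quad x^n=y^n=0,\quad xg=\omega gx,\quad gy=\omega yg,\quad xy=\omega yx,$$ with the Hopf algebra structure given by $$\Delta(g)=g\otimes g,\quad \Delta(x)=x\otimes g+1\otimes x,\quad \Delta(y)=y\otimes g+1\otimes y,$$ $$\varepsilon(g)=1,\quad \varepsilon(x)=\varepsilon(y)=0,\quad S(g)=g^{n-1},\quad S(x)=-xg^{n-1},\quad S(y)=-yg^{n-1}.$$ A Hopf $*$-algebra structure ($*$-structure) on $H$ is a conjugate-linear map $*:H\to H$, $h\mapsto h^*$, such that for all $h,l\in H$ $$(h^*)^*=h,\quad (hl)^*=l^*h^*,\quad \Delta(h^*)=(*\otimes *)\Delta(h),\quad S(S(h^*)^*)=h.$$ Two $*$-structures $*'$ and $*''$ on $H$ are equivalent if there is a Hopf algebra automorphism $\psi$ of $H$ with $\psi(h^{*'})=\psi(h)^{*''}$ for all $h\in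 H$. Then there is exactly one $*$-structure on $H$ with $g^*=g$, $x^*=x$, $y^*=y$, and any two $*$-structures on $H$ are equivalent. In other words, up to equivalence there is a unique Hopf $*$-algebra structure on $H$, the one given by $g^*=g$, $x^*=x$, $y^*=y$. -/

import Mathlib

open scoped TensorProduct

/-! ### Powers of a sum of two skew-commuting elements

These facts are needed only to see that the comultiplication of the Radford algebra respects the
relations `x ^ n = 0` and `y ^ n = 0`. -/

/-- The Gaussian binomial coefficients with parameter `q`, through the Pascal recursion. -/
def gaussBinom (q : ℂ) : ℕ → ℕ → ℂ
  | _, 0 => 1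
  | 0, _ + 1 => 0
  | m + 1, k + 1 => gaussBinom q m k + q ^ (k + 1) * gaussBinom q m (k + 1)

theorem gaussBinom_zero_right (q : ℂ) (m : ℕ) : gaussBinom q m 0 = 1 := by
  cases m <;> rfl

theorem gaussBinom_absorb (q : ℂ) (m k : ℕ) :
    (q ^ (k + 1) - 1) * gaussBinom q (m + 1) (k + 1) = (q ^ (m + 1) - 1) * gaussBinom q m k := by
  induction m generalizing k with
  | zero =>
    cases k <;> simp [gaussBinom]
  | succ m ih =>
    have h1 := ih k
    rw [gaussBinom]
    cases k with
    | zero =>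
      rw [gaussBinom_zero_right] at h1 ⊢
      linear_combination q * h1
    | succ k =>
      have h2 := ih k
      have h3 : gaussBinom q (m + 1) (k + 1)
          = gaussBinom q m k + q ^ (k + 1) * gaussBinom q m (k + 1) := rfl
      linear_combination (q ^ (k + 2)) * h1 + q * h2 - (q ^ (m + 2) - q) * h3

theorem gaussBinom_eq_zero (q : ℂ) (m k : ℕ) (h : m < k) : gaussBinom q m k = 0 := by
  induction m generalizing k with
  | zero => cases k with
    | zero => omega
    | succ k => rfl
  | succ m ih => cases k with
    | zero => omega
    | succ k => rw [gaussBinom, ih k (by omega), ih (k + 1) (by omega)]; simp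

theorem gaussBinom_self (q : ℂ) (m : ℕ) : gaussBinom q m m = 1 := by
  induction m with
  | zero => rfl
  | succ m ih => rw [gaussBinom, ih, gaussBinom_eq_zero q m (m + 1) (by omega)]; simp

theorem gaussBinom_primitive {q : ℂ} {n k : ℕ} (hq : IsPrimitiveRoot q n) (hk : 0 < k)
    (hkn : k < n) : gaussBinom q n k = 0 := by
  obtain ⟨k, rfl⟩ : ∃ j, k = j + 1 := ⟨k - 1, by omega⟩
  obtain ⟨m, rfl⟩ : ∃ j, n = j + 1 := ⟨n - 1, by omega⟩
  have h := gaussBinom_absorb q m k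
  rw [hq.pow_eq_one, sub_self, zero_mul] at h
  exact (mul_eq_zero.1 h).resolve_left
    (sub_ne_zero.2 (hq.pow_ne_one_of_pos_of_lt (by omega) hkn))

theorem skew_mul_pow {A : Type*} [Semiring A] [Algebra ℂ A] {q : ℂ} {a b : A}
    (hba : b * a = q • (a * b)) (k : ℕ) : b * a ^ k = q ^ k • (a ^ k * b) := by
  induction k with
  | zero => simp
  | succ k ih =>
    rw [pow_succ, ← mul_assoc, ih, smul_mul_assoc, mul_assoc, hba, mul_smul_comm, smul_smul,
      mul_assoc, pow_succ]

theorem skew_add_pow {A : Type*} [Semiring A] [Algebra ℂ A] {q : ℂ} {a b : A}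
    (hba : b * a = q • (a * b)) (m : ℕ) :
    (a + b) ^ m = ∑ k ∈ Finset.range (m + 1), gaussBinom q m k • (a ^ k * b ^ (m - k)) := by
  induction m with
  | zero => simp [gaussBinom]
  | succ m ih =>
    rw [pow_succ', ih, add_mul, Finset.mul_sum, Finset.mul_sum, Finset.sum_range_succ' _ (m + 1)]
    have e1 : ∀ k ∈ Finset.range (m + 1), gaussBinom q (m + 1) (k + 1)
        • (a ^ (k + 1) * b ^ (m + 1 - (k + 1)))
        = a * gaussBinom q m k • (a ^ k * b ^ (m - k))
          + (q ^ (k + 1) * gaussBinom q m (k + 1)) • (a ^ (k + 1) * b ^ (m - k)) := by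
      intro k _
      rw [gaussBinom, add_smul, mul_smul_comm, ← mul_assoc, ← pow_succ',
        Nat.add_sub_add_right]
    rw [Finset.sum_congr rfl e1, Finset.sum_add_distrib, add_assoc]
    congr 1
    rw [Finset.sum_range_succ' (fun k => b * gaussBinom q m k • (a ^ k * b ^ (m - k))) m,
      Finset.sum_range_succ (fun k => (q ^ (k + 1) * gaussBinom q m (k + 1))
        • (a ^ (k + 1) * b ^ (m - k))) m, gaussBinom_eq_zero q m (m + 1) (by omega)]
    simp only [mul_zero, zero_smul, add_zero, gaussBinom_zero_right, pow_zero, one_mul, one_smul,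
      Nat.sub_zero]
    congr 1
    · refine Finset.sum_congr rfl fun k hk => ?_
      have hk' : k < m := Finset.mem_range.1 hk
      rw [mul_smul_comm, ← mul_assoc, skew_mul_pow hba, smul_mul_assoc, smul_smul, mul_assoc,
        ← pow_succ', mul_comm (gaussBinom q m (k + 1)), show m - (k + 1) + 1 = m - k by omega]
    · rw [← pow_succ']

theorem skew_add_pow_eq_zero {A : Type*} [Semiring A] [Algebra ℂ A] {q : ℂ} {n : ℕ} {a b : A}
    (hq : IsPrimitiveRoot q n) (hba : b * a = q • (a * b)) (ha : a ^ n = 0)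
    (hb : b ^ n = 0) : (a + b) ^ n = 0 := by
  rw [skew_add_pow hba]
  refine Finset.sum_eq_zero fun k hk => ?_
  have hk' : k < n + 1 := Finset.mem_range.1 hk
  rcases Nat.eq_zero_or_pos k with rfl | h0
  · simp [hb]
  · rcases Nat.lt_or_ge k n with h1 | h1
    · rw [gaussBinom_primitive hq h0 h1, zero_smul]
    · rw [show k = n by omega]; simp [ha]

/-! ### The Radford algebra -/

/-- The three generators of the Radford algebra. -/
inductive RadfordGen : Type
  | g
  | x
  | y

/-- The defining relations of the Radford algebra, in the free algebra on `g`, `x`, `y`. -/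
inductive RadfordRel (n : ℕ) (ω : ℂ) :
    FreeAlgebra ℂ RadfordGen → FreeAlgebra ℂ RadfordGen → Prop
  | g_pow : RadfordRel n ω (FreeAlgebra.ι ℂ RadfordGen.g ^ n) 1
  | x_pow : RadfordRel n ω (FreeAlgebra.ι ℂ RadfordGen.x ^ n) 0
  | y_pow : RadfordRel n ω (FreeAlgebra.ι ℂ RadfordGen.y ^ n) 0
  | x_g : RadfordRel n ω
      (FreeAlgebra.ι ℂ RadfordGen.x * FreeAlgebra.ι ℂ RadfordGen.g)
      (ω • (FreeAlgebra.ι ℂ RadfordGen.g * FreeAlgebra.ι ℂ RadfordGen.x))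
  | g_y : RadfordRel n ω
      (FreeAlgebra.ι ℂ RadfordGen.g * FreeAlgebra.ι ℂ RadfordGen.y)
      (ω • (FreeAlgebra.ι ℂ RadfordGen.y * FreeAlgebra.ι ℂ RadfordGen.g))
  | x_y : RadfordRel n ω
      (FreeAlgebra.ι ℂ RadfordGen.x * FreeAlgebra.ι ℂ RadfordGen.y)
      (ω • (FreeAlgebra.ι ℂ RadfordGen.y * FreeAlgebra.ι ℂ RadfordGen.x))

/-- The Radford algebra: the complex algebra generated by `g`, `x`, `y` subject to `g ^ n = 1`,
`x ^ n = y ^ n = 0`, `x g = ω g x`, `g y = ω y g`, `x y = ω y x`. -/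
def RadfordAlgebra (n : ℕ) (ω : ℂ) : Type := RingQuot (RadfordRel n ω)

namespace RadfordAlgebra

noncomputable section

variable (n : ℕ) (ω : ℂ)

instance instRing : Ring (RadfordAlgebra n ω) :=
  inferInstanceAs (Ring (RingQuot (RadfordRel n ω)))

instance instAlgebra : Algebra ℂ (RadfordAlgebra n ω) :=
  inferInstanceAs (Algebra ℂ (RingQuot (RadfordRel n ω)))

/-- The quotient map from the free algebra. -/
def mk : FreeAlgebra ℂ RadfordGen →ₐ[ℂ] RadfordAlgebra n ω :=
  RingQuot.mkAlgHom ℂ (RadfordRel n ω)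

theorem mk_rel {u v : FreeAlgebra ℂ RadfordGen} (h : RadfordRel n ω u v) :
    mk n ω u = mk n ω v :=
  RingQuot.mkAlgHom_rel ℂ h

theorem mk_surjective : Function.Surjective (mk n ω) :=
  RingQuot.mkAlgHom_surjective ℂ (RadfordRel n ω)

/-- The class of a generator. -/
def of (i : RadfordGen) : RadfordAlgebra n ω := mk n ω (FreeAlgebra.ι ℂ i)

/-- The generator `g`. -/
def g : RadfordAlgebra n ω := of n ω RadfordGen.g

/-- The generator `x`. -/
def x : RadfordAlgebra n ω := of n ω RadfordGen.x

/-- The generator `y`. -/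
def y : RadfordAlgebra n ω := of n ω RadfordGen.y

theorem g_pow : g n ω ^ n = 1 := by
  simpa [g, of] using mk_rel n ω RadfordRel.g_pow

theorem x_pow : x n ω ^ n = 0 := by
  simpa [x, of] using mk_rel n ω RadfordRel.x_pow

theorem y_pow : y n ω ^ n = 0 := by
  simpa [y, of] using mk_rel n ω RadfordRel.y_pow

theorem x_mul_g : x n ω * g n ω = ω • (g n ω * x n ω) := by
  simpa [x, g, of] using mk_rel n ω RadfordRel.x_g

theorem g_mul_y : g n ω * y n ω = ω • (y n ω * g n ω) := by
  simpa [y, g, of] using mk_rel n ω RadfordRel.g_y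

theorem x_mul_y : x n ω * y n ω = ω • (y n ω * x n ω) := by
  simpa [x, y, of] using mk_rel n ω RadfordRel.x_y

/-- The choice of three elements as images of the generators. -/
def genMap {A : Type*} (a b c : A) : RadfordGen → A
  | RadfordGen.g => a
  | RadfordGen.x => b
  | RadfordGen.y => c

variable {n ω}

/-- The universal property: three elements `a`, `b`, `c` of an algebra that satisfy the defining
relations give an algebra map with `g ↦ a`, `x ↦ b`, `y ↦ c`. -/
def liftHom {A : Type*} [Semiring A] [Algebra ℂ A] (a b c : A) (h1 : a ^ n = 1) (h2 : b ^ n = 0)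
    (h3 : c ^ n = 0) (h4 : b * a = ω • (a * b)) (h5 : a * c = ω • (c * a))
    (h6 : b * c = ω • (c * b)) : RadfordAlgebra n ω →ₐ[ℂ] A :=
  RingQuot.liftAlgHom ℂ ⟨FreeAlgebra.lift ℂ (genMap a b c), by
    intro u v huv
    cases huv <;> simp [genMap, h1, h2, h3, h4, h5, h6]⟩

theorem liftHom_of {A : Type*} [Semiring A] [Algebra ℂ A] (a b c : A) (h1 : a ^ n = 1)
    (h2 : b ^ n = 0) (h3 : c ^ n = 0) (h4 : b * a = ω • (a * b)) (h5 : a * c = ω • (c * a))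
    (h6 : b * c = ω • (c * b)) (i : RadfordGen) :
    liftHom a b c h1 h2 h3 h4 h5 h6 (of n ω i) = genMap a b c i :=
  (RingQuot.liftAlgHom_mkAlgHom_apply ℂ _ _ _).trans (FreeAlgebra.lift_ι_apply _ _)

section liftHom

variable {A : Type*} [Semiring A] [Algebra ℂ A] (a b c : A) (h1 : a ^ n = 1) (h2 : b ^ n = 0)
    (h3 : c ^ n = 0) (h4 : b * a = ω • (a * b)) (h5 : a * c = ω • (c * a))
    (h6 : b * c = ω • (c * b))

theorem liftHom_g : liftHom a b c h1 h2 h3 h4 h5 h6 (g n ω) = a :=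
  liftHom_of ..

theorem liftHom_x : liftHom a b c h1 h2 h3 h4 h5 h6 (x n ω) = b :=
  liftHom_of ..

theorem liftHom_y : liftHom a b c h1 h2 h3 h4 h5 h6 (y n ω) = c :=
  liftHom_of ..

end liftHom

/-- Induction: the algebra is generated by `g`, `x`, `y`. -/
theorem induction {P : RadfordAlgebra n ω → Prop} (hg : P (g n ω)) (hx : P (x n ω))
    (hy : P (y n ω)) (hc : ∀ r : ℂ, P (algebraMap ℂ _ r))
    (hadd : ∀ u v, P u → P v → P (u + v)) (hmul : ∀ u v, P u → P v → P (u * v))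
    (h : RadfordAlgebra n ω) : P h := by
  obtain ⟨w, rfl⟩ := mk_surjective n ω h
  induction w using FreeAlgebra.induction with
  | grade0 r => simpa using hc r
  | grade1 i => cases i <;> assumption
  | mul u v hu hv => simpa using hmul _ _ hu hv
  | add u v hu hv => simpa using hadd _ _ hu hv

theorem algHom_ext {A : Type*} [Semiring A] [Algebra ℂ A] {f₁ f₂ : RadfordAlgebra n ω →ₐ[ℂ] A}
    (hg : f₁ (g n ω) = f₂ (g n ω)) (hx : f₁ (x n ω) = f₂ (x n ω))
    (hy : f₁ (y n ω) = f₂ (y n ω)) : f₁ = f₂ := by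
  apply AlgHom.ext
  intro h
  exact RadfordAlgebra.induction (P := fun h => f₁ h = f₂ h) hg hx hy (by simp)
    (fun u v hu hv => by simp [hu, hv]) (fun u v hu hv => by simp [hu, hv]) h

set_option linter.unusedSectionVars false

variable [hn : Fact (1 < n)] [hω : Fact (IsPrimitiveRoot ω n)]

theorem pow_pred_mul_g : g n ω ^ (n - 1) * g n ω = 1 := by
  rw [← pow_succ, Nat.sub_add_cancel hn.out.le, g_pow]

theorem g_mul_pow_pred : g n ω * g n ω ^ (n - 1) = 1 := by
  rw [← pow_succ', Nat.sub_add_cancel hn.out.le, g_pow]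

variable (n ω)

/-- The comultiplication: `Δ g = g ⊗ g`, `Δ x = x ⊗ g + 1 ⊗ x`, `Δ y = y ⊗ g + 1 ⊗ y`. -/
def comulHom : RadfordAlgebra n ω →ₐ[ℂ] RadfordAlgebra n ω ⊗[ℂ] RadfordAlgebra n ω :=
  liftHom (A := RadfordAlgebra n ω ⊗[ℂ] RadfordAlgebra n ω)
    (g n ω ⊗ₜ g n ω) (x n ω ⊗ₜ g n ω + 1 ⊗ₜ x n ω) (y n ω ⊗ₜ g n ω + 1 ⊗ₜ y n ω)
    (by rw [Algebra.TensorProduct.tmul_pow, g_pow]; rfl)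
    (by
      refine skew_add_pow_eq_zero hω.out ?_ ?_ ?_
      · simp [Algebra.TensorProduct.tmul_mul_tmul, x_mul_g]
      · simp [Algebra.TensorProduct.tmul_pow, x_pow]
      · simp [Algebra.TensorProduct.tmul_pow, x_pow])
    (by
      rw [add_comm]
      refine skew_add_pow_eq_zero hω.out ?_ ?_ ?_
      · simp [Algebra.TensorProduct.tmul_mul_tmul, g_mul_y]
      · simp [Algebra.TensorProduct.tmul_pow, y_pow]
      · simp [Algebra.TensorProduct.tmul_pow, y_pow])
    (by simp [mul_add, add_mul, Algebra.TensorProduct.tmul_mul_tmul, x_mul_g,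
      TensorProduct.smul_tmul'])
    (by simp [mul_add, add_mul, Algebra.TensorProduct.tmul_mul_tmul, g_mul_y,
      TensorProduct.smul_tmul'])
    (by
      simp only [mul_add, add_mul, Algebra.TensorProduct.tmul_mul_tmul, x_mul_g, x_mul_y, g_mul_y,
        TensorProduct.smul_tmul', TensorProduct.tmul_smul, smul_add, one_mul, mul_one]
      abel)

/-- The counit: `ε g = 1`, `ε x = ε y = 0`. -/
def counitHom : RadfordAlgebra n ω →ₐ[ℂ] ℂ :=
  liftHom 1 0 0 (by simp) (by simp [(lt_trans one_pos hn.out).ne'])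
    (by simp [(lt_trans one_pos hn.out).ne']) (by simp) (by simp) (by simp)

/-- The comultiplication and the counit make the Radford algebra a bialgebra. -/
instance instBialgebra : Bialgebra ℂ (RadfordAlgebra n ω) :=
  Bialgebra.ofAlgHom (comulHom n ω) (counitHom n ω)
    (by
      apply algHom_ext <;>
        simp [comulHom, liftHom_g, liftHom_x, liftHom_y, TensorProduct.tmul_add,
          TensorProduct.add_tmul, add_assoc, Algebra.TensorProduct.one_def])
    (by
      apply algHom_ext <;>
        simp [comulHom, counitHom, liftHom_g, liftHom_x, liftHom_y])
    (by
      apply algHom_ext <;>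
        simp [comulHom, counitHom, liftHom_g, liftHom_x, liftHom_y])

theorem comul_g : Coalgebra.comul (R := ℂ) (g n ω) = g n ω ⊗ₜ g n ω :=
  liftHom_g ..

theorem comul_x : Coalgebra.comul (R := ℂ) (x n ω) = x n ω ⊗ₜ g n ω + 1 ⊗ₜ x n ω :=
  liftHom_x ..

theorem comul_y : Coalgebra.comul (R := ℂ) (y n ω) = y n ω ⊗ₜ g n ω + 1 ⊗ₜ y n ω :=
  liftHom_y ..

theorem counit_g : Coalgebra.counit (R := ℂ) (g n ω) = 1 :=
  liftHom_g ..

theorem counit_x : Coalgebra.counit (R := ℂ) (x n ω) = 0 :=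
  liftHom_x ..

theorem counit_y : Coalgebra.counit (R := ℂ) (y n ω) = 0 :=
  liftHom_y ..

theorem skew_mul_pow_eq_zero {A : Type*} [Semiring A] [Algebra ℂ A] {q : ℂ} {a b : A}
    (hba : b * a = q • (a * b)) (hb : b ^ n = 0) : (b * a) ^ n = 0 := by
  have key : ∀ k : ℕ, ∃ c : ℂ, (b * a) ^ k = c • (a ^ k * b ^ k) := by
    intro k
    induction k with
    | zero => exact ⟨1, by simp⟩
    | succ k ih =>
      obtain ⟨c, hc⟩ := ih
      refine ⟨q ^ (k + 1) * c, ?_⟩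
      rw [pow_succ', hc, mul_smul_comm, mul_assoc, ← mul_assoc a, ← pow_succ', ← mul_assoc,
        skew_mul_pow hba, smul_mul_assoc, smul_smul, mul_assoc, ← pow_succ', mul_comm c]
  obtain ⟨c, hc⟩ := key n
  rw [hc, hb, mul_zero, smul_zero]

theorem g_pred_mul_x : g n ω ^ (n - 1) * x n ω = ω • (x n ω * g n ω ^ (n - 1)) := by
  have h : g n ω ^ (n - 1) * (x n ω * g n ω) * g n ω ^ (n - 1)
      = g n ω ^ (n - 1) * (ω • (g n ω * x n ω)) * g n ω ^ (n - 1) := by rw [x_mul_g]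
  rwa [mul_assoc, mul_assoc, g_mul_pow_pred, mul_one, mul_smul_comm, smul_mul_assoc,
    ← mul_assoc (g n ω ^ (n - 1)), pow_pred_mul_g, one_mul] at h

theorem y_mul_g_pred : y n ω * g n ω ^ (n - 1) = ω • (g n ω ^ (n - 1) * y n ω) := by
  have h : g n ω ^ (n - 1) * (g n ω * y n ω) * g n ω ^ (n - 1)
      = g n ω ^ (n - 1) * (ω • (y n ω * g n ω)) * g n ω ^ (n - 1) := by rw [g_mul_y]
  rwa [← mul_assoc, pow_pred_mul_g, one_mul, mul_smul_comm, smul_mul_assoc, mul_assoc, mul_assoc,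
    g_mul_pow_pred, mul_one] at h

/-- The antipode as an algebra map to the opposite algebra: `S g = g ^ (n - 1)`,
`S x = - x g ^ (n - 1)`, `S y = - y g ^ (n - 1)`. -/
def antipodeHom : RadfordAlgebra n ω →ₐ[ℂ] (RadfordAlgebra n ω)ᵐᵒᵖ :=
  liftHom (A := (RadfordAlgebra n ω)ᵐᵒᵖ) (MulOpposite.op (g n ω ^ (n - 1)))
    (MulOpposite.op (-(x n ω * g n ω ^ (n - 1))))
    (MulOpposite.op (-(y n ω * g n ω ^ (n - 1))))
    (by
      apply MulOpposite.unop_injective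
      have h : (g n ω ^ (n - 1)) ^ n = 1 := by rw [← pow_mul, mul_comm, pow_mul, g_pow, one_pow]
      simp [h])
    (by
      apply MulOpposite.unop_injective
      have h : (x n ω * g n ω ^ (n - 1)) ^ n = 0 := by
        have hinv : x n ω * g n ω ^ (n - 1) = ω⁻¹ • (g n ω ^ (n - 1) * x n ω) := by
          rw [g_pred_mul_x, smul_smul, inv_mul_cancel₀ (hω.out.ne_zero (by have := hn.out; omega)),
            one_smul]
        exact skew_mul_pow_eq_zero n hinv (x_pow n ω)
      simp [neg_pow (_ * _) n, h])
    (by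
      apply MulOpposite.unop_injective
      have h : (y n ω * g n ω ^ (n - 1)) ^ n = 0 :=
        skew_mul_pow_eq_zero n (y_mul_g_pred n ω) (y_pow n ω)
      simp [neg_pow (_ * _) n, h])
    (by
      apply MulOpposite.unop_injective
      have h : g n ω ^ (n - 1) * (x n ω * g n ω ^ (n - 1))
          = ω • (x n ω * g n ω ^ (n - 1) * g n ω ^ (n - 1)) := by
        rw [← mul_assoc, g_pred_mul_x, smul_mul_assoc]
      simp [h])
    (by
      apply MulOpposite.unop_injective
      have h : y n ω * g n ω ^ (n - 1) * g n ω ^ (n - 1)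
          = ω • (g n ω ^ (n - 1) * (y n ω * g n ω ^ (n - 1))) := by
        rw [y_mul_g_pred, smul_mul_assoc, mul_assoc, y_mul_g_pred]
      simp [h])
    (by
      apply MulOpposite.unop_injective
      have h : y n ω * g n ω ^ (n - 1) * (x n ω * g n ω ^ (n - 1))
          = ω • (x n ω * g n ω ^ (n - 1) * (y n ω * g n ω ^ (n - 1))) := by
        have hxy : x n ω * y n ω = ω • (y n ω * x n ω) := x_mul_y n ω
        have hx : g n ω ^ (n - 1) * x n ω = ω • (x n ω * g n ω ^ (n - 1)) := g_pred_mul_x n ω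
        have hy : y n ω * g n ω ^ (n - 1) = ω • (g n ω ^ (n - 1) * y n ω) := y_mul_g_pred n ω
        calc y n ω * g n ω ^ (n - 1) * (x n ω * g n ω ^ (n - 1))
            = y n ω * (g n ω ^ (n - 1) * x n ω) * g n ω ^ (n - 1) := by simp only [mul_assoc]
          _ = ω • (y n ω * x n ω) * (g n ω ^ (n - 1) * g n ω ^ (n - 1)) := by
            rw [hx]; simp only [mul_smul_comm, smul_mul_assoc, mul_assoc]
          _ = x n ω * (y n ω * g n ω ^ (n - 1)) * g n ω ^ (n - 1) := by
            rw [← hxy]; simp only [mul_assoc]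
          _ = ω • (x n ω * g n ω ^ (n - 1) * (y n ω * g n ω ^ (n - 1))) := by
            conv_lhs => rw [hy]
            simp only [mul_smul_comm, smul_mul_assoc, mul_assoc]
      simp [h])

/-- The antipode. -/
def antipodeLin : RadfordAlgebra n ω →ₗ[ℂ] RadfordAlgebra n ω :=
  (MulOpposite.opLinearEquiv ℂ).symm.toLinearMap ∘ₗ (antipodeHom n ω).toLinearMap

theorem antipodeLin_g : antipodeLin n ω (g n ω) = g n ω ^ (n - 1) := by
  simp [antipodeLin, antipodeHom, liftHom_g]

theorem antipodeLin_x : antipodeLin n ω (x n ω) = -(x n ω * g n ω ^ (n - 1)) := by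
  simp [antipodeLin, antipodeHom, liftHom_x]

theorem antipodeLin_y : antipodeLin n ω (y n ω) = -(y n ω * g n ω ^ (n - 1)) := by
  simp [antipodeLin, antipodeHom, liftHom_y]

theorem antipodeLin_one : antipodeLin n ω 1 = 1 := by
  simp [antipodeLin]

theorem antipodeLin_mul (u v : RadfordAlgebra n ω) :
    antipodeLin n ω (u * v) = antipodeLin n ω v * antipodeLin n ω u := by
  simp [antipodeLin]

theorem antipode_left_mul (t s : RadfordAlgebra n ω ⊗[ℂ] RadfordAlgebra n ω) (c : ℂ)
    (ht : LinearMap.mul' ℂ _ ((antipodeLin n ω).rTensor _ t) = algebraMap ℂ _ c) :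
    LinearMap.mul' ℂ _ ((antipodeLin n ω).rTensor _ (t * s))
      = c • LinearMap.mul' ℂ _ ((antipodeLin n ω).rTensor _ s) := by
  induction s with
  | zero => simp
  | add s₁ s₂ h₁ h₂ => rw [mul_add, map_add, map_add, h₁, h₂, map_add, map_add, smul_add]
  | tmul a b =>
    have key : LinearMap.mul' ℂ _ ((antipodeLin n ω).rTensor _ (t * a ⊗ₜ b))
        = antipodeLin n ω a * LinearMap.mul' ℂ _ ((antipodeLin n ω).rTensor _ t) * b := by
      clear ht
      induction t with
      | zero => simp
      | add t₁ t₂ h₁ h₂ => rw [add_mul, map_add, map_add, h₁, h₂, map_add, map_add, mul_add, add_mul]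
      | tmul p q => simp [antipodeLin_mul, mul_assoc]
    rw [key, ht]
    simp [Algebra.algebraMap_eq_smul_one]

theorem antipode_right_mul (t s : RadfordAlgebra n ω ⊗[ℂ] RadfordAlgebra n ω) (c : ℂ)
    (hs : LinearMap.mul' ℂ _ ((antipodeLin n ω).lTensor _ s) = algebraMap ℂ _ c) :
    LinearMap.mul' ℂ _ ((antipodeLin n ω).lTensor _ (t * s))
      = c • LinearMap.mul' ℂ _ ((antipodeLin n ω).lTensor _ t) := by
  induction t with
  | zero => simp
  | add s₁ s₂ h₁ h₂ => rw [add_mul, map_add, map_add, h₁, h₂, map_add, map_add, smul_add]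
  | tmul a b =>
    have key : LinearMap.mul' ℂ _ ((antipodeLin n ω).lTensor _ (a ⊗ₜ b * s))
        = a * LinearMap.mul' ℂ _ ((antipodeLin n ω).lTensor _ s) * antipodeLin n ω b := by
      clear hs
      induction s with
      | zero => simp
      | add t₁ t₂ h₁ h₂ => rw [mul_add, map_add, map_add, h₁, h₂, map_add, map_add, mul_add, add_mul]
      | tmul p q => simp [antipodeLin_mul, mul_assoc]
    rw [key, hs]
    simp [Algebra.algebraMap_eq_smul_one]

/-- The Hopf algebra structure of the Radford algebra. -/
instance instHopfAlgebra : HopfAlgebra ℂ (RadfordAlgebra n ω) where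
  antipode := antipodeLin n ω
  mul_antipode_rTensor_comul := by
    apply LinearMap.ext
    intro h
    simp only [LinearMap.comp_apply, Algebra.linearMap_apply]
    induction h using RadfordAlgebra.induction with
    | hg => simp [comul_g, counit_g, antipodeLin_g, pow_pred_mul_g]
    | hx => simp [comul_x, counit_x, antipodeLin_x, antipodeLin_one, mul_assoc, pow_pred_mul_g]
    | hy => simp [comul_y, counit_y, antipodeLin_y, antipodeLin_one, mul_assoc, pow_pred_mul_g]
    | hc r => simp [Algebra.algebraMap_eq_smul_one, Algebra.TensorProduct.one_def, antipodeLin_one]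
    | hadd u v hu hv => simp only [map_add, hu, hv]
    | hmul u v hu hv =>
      rw [Bialgebra.comul_mul, antipode_left_mul n ω _ _ _ hu, hv, Bialgebra.counit_mul, map_mul,
        Algebra.smul_def]
  mul_antipode_lTensor_comul := by
    apply LinearMap.ext
    intro h
    simp only [LinearMap.comp_apply, Algebra.linearMap_apply]
    induction h using RadfordAlgebra.induction with
    | hg => simp [comul_g, counit_g, antipodeLin_g, g_mul_pow_pred]
    | hx => simp [comul_x, counit_x, antipodeLin_x, antipodeLin_g]
    | hy => simp [comul_y, counit_y, antipodeLin_y, antipodeLin_g]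
    | hc r => simp [Algebra.algebraMap_eq_smul_one, Algebra.TensorProduct.one_def, antipodeLin_one]
    | hadd u v hu hv => simp only [map_add, hu, hv]
    | hmul u v hu hv =>
      rw [Bialgebra.comul_mul, antipode_right_mul n ω _ _ _ hv, hu, Bialgebra.counit_mul, mul_comm,
        map_mul, Algebra.smul_def]

theorem antipode_g : HopfAlgebra.antipode ℂ (g n ω) = g n ω ^ (n - 1) :=
  antipodeLin_g n ω

theorem antipode_x : HopfAlgebra.antipode ℂ (x n ω) = -(x n ω * g n ω ^ (n - 1)) :=
  antipodeLin_x n ω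

theorem antipode_y : HopfAlgebra.antipode ℂ (y n ω) = -(y n ω * g n ω ^ (n - 1)) :=
  antipodeLin_y n ω

end

end RadfordAlgebra

/-! ### Hopf `*`-structures -/

/-- A `*`-structure on a complex Hopf algebra `H`: a conjugate-linear map `* : H → H` with
`h** = h`, `(h l)* = l* h*`, `Δ (h*) = (* ⊗ *) (Δ h)` and `S (S (h*)*) = h`. -/
structure HopfStar (H : Type*) [Ring H] [HopfAlgebra ℂ H] where
  /-- The underlying conjugate-linear map. -/
  star : H →ₗ⋆[ℂ] H
  star_star : ∀ h, star (star h) = h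
  star_mul : ∀ h l, star (h * l) = star l * star h
  comul_star : ∀ h, Coalgebra.comul (R := ℂ) (star h)
    = TensorProduct.map star star (Coalgebra.comul (R := ℂ) h)
  antipode_star : ∀ h, HopfAlgebra.antipode ℂ (star (HopfAlgebra.antipode ℂ (star h))) = h

/-- Two `*`-structures are equivalent if some Hopf algebra automorphism `ψ`, that is, a bialgebra
automorphism that commutes with the antipode, satisfies `ψ (h*') = ψ (h)*''` for all `h`. -/
def HopfStar.Equivalent {H : Type*} [Ring H] [HopfAlgebra ℂ H] (s₁ s₂ : HopfStar H) : Prop :=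
  ∃ ψ : H ≃ₐc[ℂ] H,
    (∀ h, ψ (HopfAlgebra.antipode ℂ h) = HopfAlgebra.antipode ℂ (ψ h)) ∧
      ∀ h, ψ (s₁.star h) = s₂.star (ψ h)

open scoped ComplexConjugate

namespace RadfordAlgebra

noncomputable section

set_option linter.unusedSectionVars false

section

/-! ### Diagonalizable operators -/

/-! Existence: a `*`-structure is an algebra map into the opposite algebra with conjugated scalars,
and since `conj ω = ω⁻¹` the defining relations survive there when the generators are fixed.

Uniqueness up to equivalence rests on controlling `g*`, `x*`, `y*`, which are a group-like and two
skew-primitive elements. Representations sending `g` to a diagonal matrix and `x`, `y` to multiples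
of `E₁₂` yield, through the comultiplication, two q-derivations: one lowers the exponent of `x` in a
monomial, the other that of `y`. They are nilpotent, so they kill every group-like element, and
their common kernel lies in the span of the powers of `g` (`mem_spanG_of_skewDeriv_eq_zero`). Hence
a skew-primitive element is `a x + b y + u` with `u` in that span. Linear independence of the
monomials is never needed: it is enough that they span and that suitable operators are diagonal on
them.

The relation `x* g* = ω g* x*` then forces `g* = g` (`groupLike_eq_g`). Commutation with `g`
separates `x`, `y` and `u` by the eigenvalues `ω`, `ω⁻¹`, `1`, distinct because `n ≥ 3`, so `x* = a
x` and `y* = b y` with `a`, `b` of modulus one. Rescaling `x` and `y` by suitable square roots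
carries any such structure to any other (`exists_conj_scale`, `equivalent`). -/

/-- A polynomial in `E` that kills the nonzero eigenvalues occurring in `u`, but not the eigenvalue
`0`, projects `u` onto the wanted span up to a scalar. The `v i` may be dependent or zero. -/
theorem mem_span_of_apply_eq_zero {V ι : Type*} [AddCommGroup V] [Module ℂ V]
    (E : Module.End ℂ V) (v : ι → V) (c : ι → ℂ) (hE : ∀ i, E (v i) = c i • v i) {S : Set ι}
    {u : V} (hu : u ∈ Submodule.span ℂ (v '' S)) (h0 : E u = 0) :
    u ∈ Submodule.span ℂ (v '' {i ∈ S | c i = 0}) := by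
  have hp : ∀ (p : Polynomial ℂ) (w : V) (d : ℂ), E w = d • w →
      Polynomial.aeval E p w = p.eval d • w := by
    intro p w d hw
    by_cases h : w = 0
    · simp [h]
    · exact Module.End.aeval_apply_of_hasEigenvector
        ⟨Module.End.mem_eigenspace_iff.2 hw, h⟩
  obtain ⟨l, hl, rfl⟩ := (Finsupp.mem_span_image_iff_linearCombination ℂ).1 hu
  set p : Polynomial ℂ :=
    ∏ i ∈ l.support with c i ≠ 0, (Polynomial.X - Polynomial.C (c i)) with hpdef
  have hp0 : p.eval 0 ≠ 0 := by
    rw [hpdef, Polynomial.eval_prod]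
    refine Finset.prod_ne_zero_iff.2 fun i hi => ?_
    simpa using (Finset.mem_filter.1 hi).2
  -- Two evaluations of `p(E) u`: as a null vector of `E` it gives `p(0) u`; termwise only the
  -- indices with `c i = 0` survive.
  have h1 := hp p _ 0 (by rw [h0, zero_smul])
  have h2 : Polynomial.aeval E p (Finsupp.linearCombination ℂ v l)
      ∈ Submodule.span ℂ (v '' {i ∈ S | c i = 0}) := by
    rw [Finsupp.linearCombination_apply, Finsupp.sum, map_sum]
    refine Submodule.sum_mem _ fun i hi => ?_
    rw [map_smul, hp p _ _ (hE i)]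
    by_cases hc : c i = 0
    · exact Submodule.smul_mem _ _ (Submodule.smul_mem _ _ (Submodule.subset_span
        ⟨i, ⟨(Finsupp.mem_supported ℂ l).1 hl hi, hc⟩, rfl⟩))
    · have : p.eval (c i) = 0 := by
        rw [hpdef, Polynomial.eval_prod]
        exact Finset.prod_eq_zero (Finset.mem_filter.2 ⟨hi, hc⟩) (by simp)
      simp [this]
  rw [h1] at h2
  simpa [smul_smul, inv_mul_cancel₀ hp0] using Submodule.smul_mem _ (p.eval 0)⁻¹ h2

/-! ### Monomials -/

variable (n : ℕ) (ω : ℂ)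

/-- The monomials `y ^ a x ^ c g ^ k`. -/
def monomial (i : ℕ × ℕ × ℕ) : RadfordAlgebra n ω :=
  y n ω ^ i.1 * x n ω ^ i.2.1 * g n ω ^ i.2.2

variable {n ω}

theorem x_mul_y_pow (a : ℕ) : x n ω * y n ω ^ a = ω ^ a • (y n ω ^ a * x n ω) :=
  skew_mul_pow (x_mul_y n ω) a

theorem g_mul_y_pow (a : ℕ) : g n ω * y n ω ^ a = ω ^ a • (y n ω ^ a * g n ω) :=
  skew_mul_pow (g_mul_y n ω) a

theorem g_mul_x (hω0 : ω ≠ 0) : g n ω * x n ω = ω⁻¹ • (x n ω * g n ω) := by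
  rw [x_mul_g, smul_smul, inv_mul_cancel₀ hω0, one_smul]

theorem g_mul_x_pow (hω0 : ω ≠ 0) (a : ℕ) :
    g n ω * x n ω ^ a = ω⁻¹ ^ a • (x n ω ^ a * g n ω) :=
  skew_mul_pow (g_mul_x hω0) a

/-- The span contains `1` and is stable under left multiplication by each generator, since
reordering costs only powers of `ω`; it is therefore a left ideal containing `1`. -/
theorem span_monomial (hω0 : ω ≠ 0) : Submodule.span ℂ (Set.range (monomial n ω)) = ⊤ := by
  rw [eq_top_iff]
  have key : ∀ z : RadfordAlgebra n ω,
      (∀ i, z * monomial n ω i ∈ Submodule.span ℂ (Set.range (monomial n ω))) →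
      ∀ m ∈ Submodule.span ℂ (Set.range (monomial n ω)),
        z * m ∈ Submodule.span ℂ (Set.range (monomial n ω)) := by
    intro z hz m hm
    induction hm using Submodule.span_induction with
    | mem m hm => obtain ⟨i, rfl⟩ := hm; exact hz i
    | zero => simp
    | add u v _ _ hu hv => rw [mul_add]; exact add_mem hu hv
    | smul r u _ hu => rw [mul_smul_comm]; exact Submodule.smul_mem _ _ hu
  have main : ∀ h : RadfordAlgebra n ω, ∀ m ∈ Submodule.span ℂ (Set.range (monomial n ω)),
        h * m ∈ Submodule.span ℂ (Set.range (monomial n ω)) := by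
    intro h
    induction h using RadfordAlgebra.induction with
    | hg =>
      refine key _ fun ⟨a, c, k⟩ => ?_
      have : g n ω * monomial n ω (a, c, k)
          = (ω ^ a * ω⁻¹ ^ c) • monomial n ω (a, c, k + 1) := by
        simp only [monomial]
        rw [← mul_assoc, ← mul_assoc, g_mul_y_pow, smul_mul_assoc, mul_assoc (y n ω ^ a),
          g_mul_x_pow hω0, mul_smul_comm, smul_mul_assoc, smul_mul_assoc, smul_smul, pow_succ']
        simp only [mul_assoc]
      rw [this]
      exact Submodule.smul_mem _ _ (Submodule.subset_span ⟨_, rfl⟩)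
    | hx =>
      refine key _ fun ⟨a, c, k⟩ => ?_
      have : x n ω * monomial n ω (a, c, k) = ω ^ a • monomial n ω (a, c + 1, k) := by
        simp only [monomial]
        rw [← mul_assoc, ← mul_assoc, x_mul_y_pow, smul_mul_assoc, smul_mul_assoc, pow_succ']
        simp only [mul_assoc]
      rw [this]
      exact Submodule.smul_mem _ _ (Submodule.subset_span ⟨_, rfl⟩)
    | hy =>
      refine key _ fun ⟨a, c, k⟩ => ?_
      have : y n ω * monomial n ω (a, c, k) = monomial n ω (a + 1, c, k) := by
        simp only [monomial, pow_succ', mul_assoc]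
      rw [this]
      exact Submodule.subset_span ⟨_, rfl⟩
    | hc r =>
      intro m hm
      rw [← Algebra.smul_def]
      exact Submodule.smul_mem _ _ hm
    | hadd u v hu hv => intro m hm; rw [add_mul]; exact add_mem (hu m hm) (hv m hm)
    | hmul u v hu hv => intro m hm; rw [mul_assoc]; exact hu _ (hv m hm)
  intro h _
  simpa using main h 1 (Submodule.subset_span ⟨(0, 0, 0), by simp [monomial]⟩)

/-! ### Skew derivations -/

/-- The corner entry is the q-derivative of `z ^ m`; this is where the q-integers `1 + q + ⋯ + q ^
(m - 1)` come from. At `m = 0` the truncated exponent is harmless because the sum is empty. -/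
theorem upper_triangular_pow {A : Type*} [Ring A] [Algebra ℂ A] (z : A) (q α : ℂ) (m : ℕ) :
    (!![z, algebraMap ℂ A α; 0, q • z] : Matrix (Fin 2) (Fin 2) A) ^ m
      = !![z ^ m, (α * ∑ i ∈ Finset.range m, q ^ i) • z ^ (m - 1); 0, q ^ m • z ^ m] := by
  induction m with
  | zero => simp [Matrix.one_fin_two]
  | succ m ih =>
    rw [pow_succ', ih, Matrix.mul_fin_two]
    have h : z * (α * ∑ i ∈ Finset.range m, q ^ i) • z ^ (m - 1)
        + algebraMap ℂ A α * q ^ m • z ^ m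
        = (α * ∑ i ∈ Finset.range (m + 1), q ^ i) • z ^ (m + 1 - 1) := by
      rw [← Algebra.smul_def, smul_smul, Finset.sum_range_succ, mul_add, add_smul,
        Nat.add_sub_cancel, mul_smul_comm]
      cases m with
      | zero => simp
      | succ m => rw [Nat.add_sub_cancel, ← pow_succ']
    rw [h]
    simp [pow_succ', smul_smul, mul_comm q]

variable [hn : Fact (1 < n)] [hω : Fact (IsPrimitiveRoot ω n)]

theorem omega_ne_zero (n : ℕ) {ω : ℂ} [hn : Fact (1 < n)] [hω : Fact (IsPrimitiveRoot ω n)] :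
    ω ≠ 0 :=
  hω.out.ne_zero (lt_trans one_pos hn.out).ne'

theorem strictUpper_sq (α : ℂ) : (!![0, α; 0, 0] : Matrix (Fin 2) (Fin 2) ℂ) ^ 2 = 0 := by
  ext i j
  fin_cases i <;> fin_cases j <;> simp [pow_two]

/-- The triangular representation `g ↦ diag (1, q)`, `x ↦ α E₁₂`, `y ↦ β E₁₂`. -/
def triangularRep (q α β : ℂ) (hq : q ^ n = 1) (hα : α * q = ω * α) (hβ : β = ω * (β * q)) :
    RadfordAlgebra n ω →ₐ[ℂ] Matrix (Fin 2) (Fin 2) ℂ :=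
  liftHom !![1, 0; 0, q] !![0, α; 0, 0] !![0, β; 0, 0]
    (by
      -- With `z = 1` and zero corner the matrix is `diag (1, q)`.
      have h := upper_triangular_pow (A := ℂ) 1 q 0 n
      simpa [hq, Matrix.one_fin_two] using h)
    (pow_eq_zero_of_le hn.out (strictUpper_sq _))
    (pow_eq_zero_of_le hn.out (strictUpper_sq _))
    (by ext i j; fin_cases i <;> fin_cases j <;> simp [hα])
    (by simpa [mul_comm β] using hβ)
    (by ext i j; fin_cases i <;> fin_cases j <;> simp)

/-- The algebra map `(id ⊗ ρ) ∘ Δ`, with values in matrices. -/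
def coaction (ρ : RadfordAlgebra n ω →ₐ[ℂ] Matrix (Fin 2) (Fin 2) ℂ) :
    RadfordAlgebra n ω →ₐ[ℂ] Matrix (Fin 2) (Fin 2) (RadfordAlgebra n ω) :=
  (matrixEquivTensor (Fin 2) ℂ (RadfordAlgebra n ω)).symm.toAlgHom.comp
    ((Algebra.TensorProduct.map (AlgHom.id ℂ _) ρ).comp
      (Bialgebra.comulAlgHom ℂ (RadfordAlgebra n ω)))

/-- The upper right entry of the matrix `((id ⊗ ρ) ∘ Δ) u`. -/
def skewDeriv (ρ : RadfordAlgebra n ω →ₐ[ℂ] Matrix (Fin 2) (Fin 2) ℂ) :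
    RadfordAlgebra n ω →ₗ[ℂ] RadfordAlgebra n ω :=
  Matrix.entryLinearMap ℂ _ 0 1 ∘ₗ (coaction ρ).toLinearMap

theorem skewDeriv_apply (ρ : RadfordAlgebra n ω →ₐ[ℂ] Matrix (Fin 2) (Fin 2) ℂ)
    (u : RadfordAlgebra n ω) : skewDeriv ρ u = coaction ρ u 0 1 := rfl

/-- A group-like element is an eigenvector of every such operator, so nilpotency will force the
eigenvalue to vanish. -/
theorem skewDeriv_of_comul_eq_tmul (ρ : RadfordAlgebra n ω →ₐ[ℂ] Matrix (Fin 2) (Fin 2) ℂ)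
    {G : RadfordAlgebra n ω} (h : Coalgebra.comul (R := ℂ) G = G ⊗ₜ G) :
    skewDeriv ρ G = ρ G 0 1 • G := by
  simp [skewDeriv, coaction, h, matrixEquivTensor_apply_symm, Algebra.smul_def,
    Algebra.commutes]

theorem skewDeriv_of_comul_eq_add (ρ : RadfordAlgebra n ω →ₐ[ℂ] Matrix (Fin 2) (Fin 2) ℂ)
    {X G : RadfordAlgebra n ω} (h : Coalgebra.comul (R := ℂ) X = X ⊗ₜ G + 1 ⊗ₜ X) :
    skewDeriv ρ X = ρ G 0 1 • X + algebraMap ℂ _ (ρ X 0 1) := by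
  simp [skewDeriv, coaction, h, matrixEquivTensor_apply_symm, Algebra.smul_def,
    Algebra.commutes]

section triangularRep

variable (q α β : ℂ) (hq : q ^ n = 1) (hα : α * q = ω * α) (hβ : β = ω * (β * q))

theorem coaction_g : coaction (triangularRep q α β hq hα hβ) (g n ω)
    = !![g n ω, algebraMap ℂ _ 0; 0, q • g n ω] := by
  ext i j
  fin_cases i <;> fin_cases j <;>
    simp [coaction, comul_g, triangularRep, liftHom_g, matrixEquivTensor_apply_symm,
      Algebra.smul_def, Algebra.commutes]

theorem coaction_x : coaction (triangularRep q α β hq hα hβ) (x n ω)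
    = !![x n ω, algebraMap ℂ _ α; 0, q • x n ω] := by
  ext i j
  fin_cases i <;> fin_cases j <;>
    simp [coaction, comul_x, triangularRep, liftHom_g, liftHom_x, matrixEquivTensor_apply_symm,
      Algebra.smul_def, Algebra.commutes]

theorem coaction_y : coaction (triangularRep q α β hq hα hβ) (y n ω)
    = !![y n ω, algebraMap ℂ _ β; 0, q • y n ω] := by
  ext i j
  fin_cases i <;> fin_cases j <;>
    simp [coaction, comul_y, triangularRep, liftHom_g, liftHom_y, matrixEquivTensor_apply_symm,
      Algebra.smul_def, Algebra.commutes]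

/-- Multiplicativity of the coaction reduces this to a product of three triangular matrices. The
powers of `q` come from the lower right entries of the factors to the right of the one
differentiated. -/
theorem skewDeriv_monomial (a c k : ℕ) :
    skewDeriv (triangularRep q α β hq hα hβ) (monomial n ω (a, c, k))
      = (α * (∑ i ∈ Finset.range c, q ^ i) * q ^ k) • monomial n ω (a, c - 1, k)
        + (β * (∑ i ∈ Finset.range a, q ^ i) * q ^ c * q ^ k) • monomial n ω (a - 1, c, k) := by
  rw [skewDeriv_apply, monomial]
  simp only [map_mul, map_pow, coaction_g, coaction_x, coaction_y]
  rw [upper_triangular_pow, upper_triangular_pow, upper_triangular_pow, Matrix.mul_fin_two,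
    Matrix.mul_fin_two]
  simp [monomial, smul_smul, add_mul, mul_comm]

end triangularRep

end

/-! ### The two q-derivations and their common kernel -/

section

variable {n : ℕ} {ω : ℂ} [hn : Fact (1 < n)] [hω : Fact (IsPrimitiveRoot ω n)]

variable (n ω)

/-- The representation `g ↦ diag (1, ω)`, `x ↦ E₁₂`, `y ↦ 0`. -/
def repX : RadfordAlgebra n ω →ₐ[ℂ] Matrix (Fin 2) (Fin 2) ℂ :=
  triangularRep ω 1 0 hω.out.pow_eq_one (by simp) (by simp)

/-- The representation `g ↦ diag (1, ω⁻¹)`, `x ↦ 0`, `y ↦ E₁₂`. -/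
def repY : RadfordAlgebra n ω →ₐ[ℂ] Matrix (Fin 2) (Fin 2) ℂ :=
  triangularRep ω⁻¹ 0 1 hω.out.inv.pow_eq_one (by simp)
    (by rw [one_mul, mul_inv_cancel₀ (omega_ne_zero n)])

/-- The span of the powers of `g`. -/
def spanG : Submodule ℂ (RadfordAlgebra n ω) :=
  Submodule.span ℂ (Set.range fun k : ℕ => g n ω ^ k)

variable {n ω}

theorem skewDeriv_repX_monomial (a c k : ℕ) :
    skewDeriv (repX n ω) (monomial n ω (a, c, k))
      = ((∑ i ∈ Finset.range c, ω ^ i) * ω ^ k) • monomial n ω (a, c - 1, k) := by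
  rw [repX, skewDeriv_monomial]
  simp

theorem skewDeriv_repY_monomial (a c k : ℕ) :
    skewDeriv (repY n ω) (monomial n ω (a, c, k))
      = ((∑ i ∈ Finset.range a, ω⁻¹ ^ i) * ω⁻¹ ^ c * ω⁻¹ ^ k) • monomial n ω (a - 1, c, k) := by
  rw [repY, skewDeriv_monomial]
  simp

theorem skewDeriv_repX_x : skewDeriv (repX n ω) (x n ω) = 1 := by
  simpa [monomial] using skewDeriv_repX_monomial (n := n) (ω := ω) 0 1 0

theorem skewDeriv_repX_y : skewDeriv (repX n ω) (y n ω) = 0 := by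
  simpa [monomial] using skewDeriv_repX_monomial (n := n) (ω := ω) 1 0 0

theorem skewDeriv_repX_g_pow (k : ℕ) : skewDeriv (repX n ω) (g n ω ^ k) = 0 := by
  simpa [monomial] using skewDeriv_repX_monomial (n := n) (ω := ω) 0 0 k

theorem skewDeriv_repY_x : skewDeriv (repY n ω) (x n ω) = 0 := by
  simpa [monomial] using skewDeriv_repY_monomial (n := n) (ω := ω) 0 1 0

theorem skewDeriv_repY_y : skewDeriv (repY n ω) (y n ω) = 1 := by
  simpa [monomial] using skewDeriv_repY_monomial (n := n) (ω := ω) 1 0 0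

theorem skewDeriv_repY_g_pow (k : ℕ) : skewDeriv (repY n ω) (g n ω ^ k) = 0 := by
  simpa [monomial] using skewDeriv_repY_monomial (n := n) (ω := ω) 0 0 k

theorem geom_sum_ne_zero {q : ℂ} (hq : IsPrimitiveRoot q n) {c : ℕ} (h0 : c ≠ 0) (hc : c < n) :
    ∑ i ∈ Finset.range c, q ^ i ≠ 0 := by
  intro h
  have := geom_sum_mul q c
  rw [h, zero_mul] at this
  exact hq.pow_ne_one_of_pos_of_lt h0 hc (sub_eq_zero.1 this.symm)

theorem mem_span_monomial_univ (u : RadfordAlgebra n ω) :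
    u ∈ Submodule.span ℂ (monomial n ω '' Set.univ) := by
  rw [Set.image_univ, span_monomial (omega_ne_zero n)]
  trivial

/-- Multiplying each derivation by the variable it removes gives an operator diagonal on monomials.
Its eigenvalue is a unit times a q-integer, which is nonzero for exponents strictly between `0` and
`n`. -/
theorem mem_spanG_of_skewDeriv_eq_zero {u : RadfordAlgebra n ω}
    (hx : skewDeriv (repX n ω) u = 0) (hy : skewDeriv (repY n ω) u = 0) : u ∈ spanG n ω := by
  have hω0 : ω ≠ 0 := omega_ne_zero n
  have h1 := mem_span_of_apply_eq_zero
    (LinearMap.mulLeft ℂ (x n ω) ∘ₗ skewDeriv (repX n ω)) (monomial n ω)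
    -- The last factor `ω ^ a` is the cost of moving the restored `x` past `y ^ a`.
    (fun i => (∑ j ∈ Finset.range i.2.1, ω ^ j) * ω ^ i.2.2 * ω ^ i.1) (by
      rintro ⟨a, c, k⟩
      simp only [LinearMap.comp_apply, skewDeriv_repX_monomial, map_smul,
        LinearMap.mulLeft_apply]
      cases c with
      | zero => simp
      | succ c =>
        have : x n ω * monomial n ω (a, c, k) = ω ^ a • monomial n ω (a, c + 1, k) := by
          simp only [monomial]
          rw [← mul_assoc, ← mul_assoc, x_mul_y_pow, smul_mul_assoc, smul_mul_assoc, pow_succ']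
          simp only [mul_assoc]
        rw [Nat.add_sub_cancel, this, smul_smul]) (mem_span_monomial_univ u) (by simp [hx])
  have h2 := mem_span_of_apply_eq_zero
    (LinearMap.mulLeft ℂ (y n ω) ∘ₗ skewDeriv (repY n ω)) (monomial n ω)
    (fun i => (∑ j ∈ Finset.range i.1, ω⁻¹ ^ j) * ω⁻¹ ^ i.2.1 * ω⁻¹ ^ i.2.2) (by
      rintro ⟨a, c, k⟩
      simp only [LinearMap.comp_apply, skewDeriv_repY_monomial, map_smul,
        LinearMap.mulLeft_apply]
      cases a with
      | zero => simp
      | succ a =>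
        have : y n ω * monomial n ω (a, c, k) = monomial n ω (a + 1, c, k) := by
          simp only [monomial, pow_succ', mul_assoc]
        rw [Nat.add_sub_cancel, this]) h1 (by simp [hy])
  refine Submodule.span_le.2 ?_ h2
  rintro _ ⟨⟨a, c, k⟩, ⟨⟨-, hc⟩, ha⟩, rfl⟩
  simp only [mul_eq_zero, pow_eq_zero_iff', hω0, inv_eq_zero, false_and, or_false] at hc ha
  -- Exponents are unbounded in the index set; from `n` on, the monomial is zero.
  by_cases hcn : n ≤ c
  · simp [monomial, pow_eq_zero_of_le hcn (x_pow n ω)]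
  by_cases han : n ≤ a
  · simp [monomial, pow_eq_zero_of_le han (y_pow n ω)]
  have hc0 : c = 0 := by
    by_contra h
    exact geom_sum_ne_zero hω.out h (by omega) hc
  have ha0 : a = 0 := by
    by_contra h
    exact geom_sum_ne_zero hω.out.inv h (by omega) ha
  subst hc0 ha0
  exact Submodule.subset_span ⟨k, by simp [monomial]⟩

theorem pow_apply_eq_zero_of_monomial (D : Module.End ℂ (RadfordAlgebra n ω))
    (h : ∀ a c k, (D ^ n) (monomial n ω (a, c, k)) = 0) (u : RadfordAlgebra n ω) :
    (D ^ n) u = 0 := by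
  have hu := mem_span_monomial_univ u
  induction hu using Submodule.span_induction with
  | mem m hm => obtain ⟨⟨a, c, k⟩, -, rfl⟩ := hm; exact h a c k
  | zero => simp
  | add u v _ _ hu hv => rw [map_add, hu, hv, add_zero]
  | smul r u _ hu => rw [map_smul, hu, smul_zero]

/-- Each application lowers the exponent of `x` by one, and nonzero monomials have that exponent
below `n`. -/
theorem skewDeriv_repX_pow (u : RadfordAlgebra n ω) :
    ((skewDeriv (repX n ω) : Module.End ℂ (RadfordAlgebra n ω)) ^ n) u = 0 := by
  have key : ∀ c a k : ℕ, ((skewDeriv (repX n ω) : Module.End ℂ (RadfordAlgebra n ω)) ^ (c + 1))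
      (monomial n ω (a, c, k)) = 0 := by
    intro c a k
    induction c with
    | zero => simp [skewDeriv_repX_monomial]
    | succ c ih =>
      rw [pow_succ, Module.End.mul_apply, skewDeriv_repX_monomial, map_smul, Nat.add_sub_cancel,
        ih, smul_zero]
  refine pow_apply_eq_zero_of_monomial _ (fun a c k => ?_) u
  by_cases hc : n ≤ c
  · simp [monomial, pow_eq_zero_of_le hc (x_pow n ω)]
  · rw [← pow_sub_mul_pow _ (by omega : c + 1 ≤ n), Module.End.mul_apply, key, map_zero]

theorem skewDeriv_repY_pow (u : RadfordAlgebra n ω) :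
    ((skewDeriv (repY n ω) : Module.End ℂ (RadfordAlgebra n ω)) ^ n) u = 0 := by
  have key : ∀ a c k : ℕ, ((skewDeriv (repY n ω) : Module.End ℂ (RadfordAlgebra n ω)) ^ (a + 1))
      (monomial n ω (a, c, k)) = 0 := by
    intro a c k
    induction a with
    | zero => simp [skewDeriv_repY_monomial]
    | succ a ih =>
      rw [pow_succ, Module.End.mul_apply, skewDeriv_repY_monomial, map_smul, Nat.add_sub_cancel,
        ih, smul_zero]
  refine pow_apply_eq_zero_of_monomial _ (fun a c k => ?_) u
  by_cases ha : n ≤ a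
  · simp [monomial, pow_eq_zero_of_le ha (y_pow n ω)]
  · rw [← pow_sub_mul_pow _ (by omega : a + 1 ≤ n), Module.End.mul_apply, key, map_zero]

/-! ### Group-like and skew-primitive elements -/

theorem rep_apply_eq_zero_of_groupLike
    (ρ : RadfordAlgebra n ω →ₐ[ℂ] Matrix (Fin 2) (Fin 2) ℂ)
    (hρ : ∀ u, ((skewDeriv ρ : Module.End ℂ (RadfordAlgebra n ω)) ^ n) u = 0)
    {G : RadfordAlgebra n ω} (hG : Coalgebra.comul (R := ℂ) G = G ⊗ₜ G) (hG0 : G ≠ 0) :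
    ρ G 0 1 = 0 := by
  have h1 : ∀ m : ℕ, ((skewDeriv ρ : Module.End ℂ (RadfordAlgebra n ω)) ^ m) G
      = (ρ G 0 1) ^ m • G := by
    intro m
    induction m with
    | zero => simp
    | succ m ih =>
      rw [pow_succ, Module.End.mul_apply, skewDeriv_of_comul_eq_tmul ρ hG, map_smul, ih,
        smul_smul, pow_succ']
  have h2 := (h1 n).symm.trans (hρ G)
  exact eq_zero_of_pow_eq_zero ((smul_eq_zero.1 h2).resolve_right hG0)

theorem comul_g_pow (k : ℕ) :
    Coalgebra.comul (R := ℂ) (g n ω ^ k) = (g n ω ^ k) ⊗ₜ (g n ω ^ k) := by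
  rw [Bialgebra.comul_pow, comul_g, Algebra.TensorProduct.tmul_pow]

instance instNontrivial : Nontrivial (RadfordAlgebra n ω) :=
  (Bialgebra.counitAlgHom ℂ (RadfordAlgebra n ω)).toRingHom.domain_nontrivial

theorem commute_of_mem_spanG {u v : RadfordAlgebra n ω} (hu : u ∈ spanG n ω)
    (hv : v ∈ spanG n ω) : u * v = v * u := by
  induction hu using Submodule.span_induction with
  | zero => simp
  | add a b _ _ ha hb => rw [add_mul, mul_add, ha, hb]
  | smul r a _ ha => rw [smul_mul_assoc, mul_smul_comm, ha]
  | mem a ha =>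
    obtain ⟨k, rfl⟩ := ha
    induction hv using Submodule.span_induction with
    | zero => simp
    | add a b _ _ ha hb => rw [add_mul, mul_add, ha, hb]
    | smul r a _ ha => rw [smul_mul_assoc, mul_smul_comm, ha]
    | mem b hb =>
      obtain ⟨l, rfl⟩ := hb
      simp only [← pow_add, add_comm]

/-- The contraction of the left leg of the comultiplication with the upper right entry of a
matrix representation. -/
def leftContract (ρ : RadfordAlgebra n ω →ₐ[ℂ] Matrix (Fin 2) (Fin 2) ℂ) :
    RadfordAlgebra n ω →ₗ[ℂ] RadfordAlgebra n ω :=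
  (TensorProduct.lid ℂ _).toLinearMap ∘ₗ
    (Matrix.entryLinearMap ℂ ℂ (0 : Fin 2) (1 : Fin 2) ∘ₗ ρ.toLinearMap).rTensor _ ∘ₗ
      Coalgebra.comul

theorem leftContract_of_comul_eq_tmul (ρ : RadfordAlgebra n ω →ₐ[ℂ] Matrix (Fin 2) (Fin 2) ℂ)
    {G : RadfordAlgebra n ω} (h : Coalgebra.comul (R := ℂ) G = G ⊗ₜ G) :
    leftContract ρ G = ρ G 0 1 • G := by
  simp [leftContract, h]

theorem leftContract_of_comul_eq_add (ρ : RadfordAlgebra n ω →ₐ[ℂ] Matrix (Fin 2) (Fin 2) ℂ)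
    {X G : RadfordAlgebra n ω} (h : Coalgebra.comul (R := ℂ) X = X ⊗ₜ G + 1 ⊗ₜ X) :
    leftContract ρ X = ρ X 0 1 • G := by
  simp [leftContract, h]

/-- On a group-like element, left and right contraction agree, so vanishing of the derivation
transfers. -/
theorem leftContract_eq_zero_of_mem_spanG
    (ρ : RadfordAlgebra n ω →ₐ[ℂ] Matrix (Fin 2) (Fin 2) ℂ)
    (hρ : ∀ k, skewDeriv ρ (g n ω ^ k) = 0) {u : RadfordAlgebra n ω} (hu : u ∈ spanG n ω) :
    leftContract ρ u = 0 := by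
  refine LinearMap.mem_ker.1 (Submodule.span_le.2 ?_ hu)
  rintro _ ⟨k, rfl⟩
  change leftContract ρ (g n ω ^ k) = 0
  rw [leftContract_of_comul_eq_tmul ρ (comul_g_pow k),
    ← skewDeriv_of_comul_eq_tmul ρ (comul_g_pow k), hρ]

theorem x_ne_zero : x n ω ≠ 0 := fun h => by
  simpa [h] using skewDeriv_repX_x (n := n) (ω := ω)

theorem y_ne_zero : y n ω ≠ 0 := fun h => by
  simpa [h] using skewDeriv_repY_y (n := n) (ω := ω)

theorem repX_x : repX n ω (x n ω) 0 1 = 1 := by simp [repX, triangularRep, liftHom_x]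
theorem repX_y : repX n ω (y n ω) 0 1 = 0 := by simp [repX, triangularRep, liftHom_y]
theorem repY_x : repY n ω (x n ω) 0 1 = 0 := by simp [repY, triangularRep, liftHom_x]
theorem repY_y : repY n ω (y n ω) 0 1 = 1 := by simp [repY, triangularRep, liftHom_y]

/-- The derivations send `X` to constants `a` and `b`, so `X - a x - b y` lies in both kernels.
Contracting the left leg of `Δ X` instead recovers `a G` and `b G`, which ties `G` to `g` as soon as
`a` or `b` is nonzero. -/
theorem skewPrimitive_sub_mem_spanG {X G : RadfordAlgebra n ω}
    (hG : Coalgebra.comul (R := ℂ) G = G ⊗ₜ G) (hG0 : G ≠ 0)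
    (hX : Coalgebra.comul (R := ℂ) X = X ⊗ₜ G + 1 ⊗ₜ X) :
    ∃ a b : ℂ, ∃ u, skewDeriv (repX n ω) u = 0 ∧ skewDeriv (repY n ω) u = 0 ∧ u ∈ spanG n ω ∧
      X = a • x n ω + b • y n ω + u ∧ a • G = a • g n ω ∧ b • G = b • g n ω := by
  have hx := rep_apply_eq_zero_of_groupLike _ skewDeriv_repX_pow hG hG0
  have hy := rep_apply_eq_zero_of_groupLike _ skewDeriv_repY_pow hG hG0
  have h1 := skewDeriv_of_comul_eq_add (repX n ω) hX
  have h2 := skewDeriv_of_comul_eq_add (repY n ω) hX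
  rw [hx, zero_smul, zero_add, Algebra.algebraMap_eq_smul_one] at h1
  rw [hy, zero_smul, zero_add, Algebra.algebraMap_eq_smul_one] at h2
  have h3 := leftContract_of_comul_eq_add (repX n ω) hX
  have h4 := leftContract_of_comul_eq_add (repY n ω) hX
  generalize repX n ω X 0 1 = a at h1 h3
  generalize repY n ω X 0 1 = b at h2 h4
  obtain ⟨u, hu⟩ : ∃ u, X = a • x n ω + b • y n ω + u := ⟨X - (a • x n ω + b • y n ω), by abel⟩
  have hux : skewDeriv (repX n ω) u = 0 := by
    rw [hu] at h1
    simpa [skewDeriv_repX_x, skewDeriv_repX_y] using h1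
  have huy : skewDeriv (repY n ω) u = 0 := by
    rw [hu] at h2
    simpa [skewDeriv_repY_x, skewDeriv_repY_y] using h2
  have hmem := mem_spanG_of_skewDeriv_eq_zero hux huy
  refine ⟨a, b, u, hux, huy, hmem, hu, ?_, ?_⟩
  -- The left contraction of `X` is `a G` by skew-primitivity and `a g` by the decomposition.
  · rw [← h3, hu]
    simp [leftContract_of_comul_eq_add _ (comul_x n ω), leftContract_of_comul_eq_add _
      (comul_y n ω), leftContract_eq_zero_of_mem_spanG _ skewDeriv_repX_g_pow hmem, repX_x, repX_y]
  · rw [← h4, hu]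
    simp [leftContract_of_comul_eq_add _ (comul_x n ω), leftContract_of_comul_eq_add _
      (comul_y n ω), leftContract_eq_zero_of_mem_spanG _ skewDeriv_repY_g_pow hmem, repY_x, repY_y]

/-- If neither coefficient of `X` survives, then `X` and `G` both lie in the commutative span of the
powers of `g`, which contradicts `X G = ω G X` because `ω ≠ 1`. -/
theorem groupLike_eq_g {X G : RadfordAlgebra n ω}
    (hG : Coalgebra.comul (R := ℂ) G = G ⊗ₜ G) (hGu : IsUnit G)
    (hX : Coalgebra.comul (R := ℂ) X = X ⊗ₜ G + 1 ⊗ₜ X) (hX0 : X ≠ 0)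
    (hXG : X * G = ω • (G * X)) : G = g n ω := by
  obtain ⟨a, b, u, -, -, hu, rfl, ha, hb⟩ := skewPrimitive_sub_mem_spanG hG hGu.ne_zero hX
  by_cases ha0 : a = 0
  · by_cases hb0 : b = 0
    · exfalso
      subst ha0 hb0
      simp only [zero_smul, zero_add] at hXG hX0
      have hGmem : G ∈ spanG n ω := by
        apply mem_spanG_of_skewDeriv_eq_zero
        · rw [skewDeriv_of_comul_eq_tmul _ hG, rep_apply_eq_zero_of_groupLike _
            skewDeriv_repX_pow hG hGu.ne_zero, zero_smul]
        · rw [skewDeriv_of_comul_eq_tmul _ hG, rep_apply_eq_zero_of_groupLike _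
            skewDeriv_repY_pow hG hGu.ne_zero, zero_smul]
      rw [commute_of_mem_spanG hu hGmem] at hXG
      have h : (1 - ω) • (G * u) = 0 := by rw [sub_smul, one_smul, ← hXG, sub_self]
      rcases smul_eq_zero.1 h with h | h
      · exact hω.out.ne_one hn.out (sub_eq_zero.1 h).symm
      · exact hX0 (hGu.mul_right_eq_zero.1 h)
    · exact smul_right_injective _ hb0 hb
  · exact smul_right_injective _ ha0 ha

theorem isUnit_g : IsUnit (g n ω) :=
  IsUnit.of_pow_eq_one (g_pow n ω) (lt_trans one_pos hn.out).ne'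

/-- The components `x`, `y`, `u` skew-commute with `g` with factors `ω`, `ω⁻¹`, `1`; the two
derivations read off the coefficients of the resulting relation, and `μ ≠ 1` then removes `u`. -/
theorem skewPrimitive_eigenvector {X : RadfordAlgebra n ω} {μ : ℂ} (hμ : μ ≠ 1)
    (hX : Coalgebra.comul (R := ℂ) X = X ⊗ₜ g n ω + 1 ⊗ₜ X)
    (hXg : X * g n ω = μ • (g n ω * X)) :
    ∃ a b : ℂ, X = a • x n ω + b • y n ω ∧ a * (ω - μ) = 0 ∧ b * (ω⁻¹ - μ) = 0 := by
  obtain ⟨a, b, u, hux, huy, hu, rfl, -, -⟩ :=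
    skewPrimitive_sub_mem_spanG (comul_g n ω) isUnit_g.ne_zero hX
  have hug : u * g n ω = g n ω * u :=
    commute_of_mem_spanG hu (Submodule.subset_span ⟨1, by simp⟩)
  have hyg : y n ω * g n ω = ω⁻¹ • (g n ω * y n ω) := by
    rw [g_mul_y, smul_smul, inv_mul_cancel₀ (omega_ne_zero n), one_smul]
  have h : (a * (ω - μ)) • x n ω + (b * (ω⁻¹ - μ)) • y n ω + (1 - μ) • u = 0 := by
    -- After multiplication by the unit `g` on the left, the claim is the relation `hXg` rearranged.
    apply isUnit_g.mul_right_eq_zero.1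
    simp only [add_mul, mul_add, smul_mul_assoc, mul_smul_comm, x_mul_g, hyg, hug] at hXg ⊢
    rw [← sub_eq_zero] at hXg
    rw [← hXg]
    module
  have h1 := congrArg (skewDeriv (repX n ω)) h
  have h2 := congrArg (skewDeriv (repY n ω)) h
  simp only [map_add, map_smul, map_zero, skewDeriv_repX_x, skewDeriv_repX_y, hux, smul_zero,
    add_zero] at h1
  simp only [map_add, map_smul, map_zero, skewDeriv_repY_x, skewDeriv_repY_y, huy, smul_zero,
    add_zero, zero_add] at h2
  have h1' := (smul_eq_zero.1 h1).resolve_right one_ne_zero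
  have h2' := (smul_eq_zero.1 h2).resolve_right one_ne_zero
  rw [h1', h2', zero_smul, zero_smul, zero_add, zero_add] at h
  have hu0 := (smul_eq_zero.1 h).resolve_left (sub_ne_zero.2 hμ.symm)
  exact ⟨a, b, by rw [hu0, add_zero], h1', h2'⟩

end

section

/-! ### The standard `*`-structure -/

/-- The opposite of the Radford algebra, with scalars acting through complex conjugation. -/
def ConjOpposite (n : ℕ) (ω : ℂ) : Type := (RadfordAlgebra n ω)ᵐᵒᵖ

instance (n : ℕ) (ω : ℂ) : Ring (ConjOpposite n ω) :=
  inferInstanceAs (Ring (RadfordAlgebra n ω)ᵐᵒᵖ)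

instance (n : ℕ) (ω : ℂ) : Algebra ℂ (ConjOpposite n ω) :=
  Algebra.compHom (RadfordAlgebra n ω)ᵐᵒᵖ (starRingEnd ℂ)

variable {n : ℕ} {ω : ℂ}

/-- The canonical identification with the underlying set of the Radford algebra. -/
def ConjOpposite.toRadford (u : ConjOpposite n ω) : RadfordAlgebra n ω := MulOpposite.unop u

/-- The canonical identification with the underlying set of the Radford algebra. -/
def ConjOpposite.ofRadford (u : RadfordAlgebra n ω) : ConjOpposite n ω := MulOpposite.op u

namespace ConjOpposite

theorem toRadford_injective : Function.Injective (toRadford (n := n) (ω := ω)) :=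
  MulOpposite.unop_injective

theorem toRadford_ofRadford (u : RadfordAlgebra n ω) : toRadford (ofRadford u) = u := rfl
theorem toRadford_one : toRadford (1 : ConjOpposite n ω) = 1 := rfl
theorem toRadford_zero : toRadford (0 : ConjOpposite n ω) = 0 := rfl
theorem toRadford_add (u v : ConjOpposite n ω) :
    toRadford (u + v) = toRadford u + toRadford v := rfl
theorem toRadford_mul (u v : ConjOpposite n ω) :
    toRadford (u * v) = toRadford v * toRadford u := rfl
theorem toRadford_smul (r : ℂ) (u : ConjOpposite n ω) :
    toRadford (r • u) = conj r • toRadford u := rfl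
theorem toRadford_pow (u : ConjOpposite n ω) (m : ℕ) :
    toRadford (u ^ m) = toRadford u ^ m := MulOpposite.unop_pow (α := RadfordAlgebra n ω) u m

end ConjOpposite

variable [hn : Fact (1 < n)] [hω : Fact (IsPrimitiveRoot ω n)]

theorem conj_omega (n : ℕ) {ω : ℂ} [hn : Fact (1 < n)] [hω : Fact (IsPrimitiveRoot ω n)] :
    conj ω = ω⁻¹ :=
  (Complex.inv_eq_conj (hω.out.norm'_eq_one (lt_trans one_pos hn.out).ne')).symm

open ConjOpposite in
/-- The standard `*`-structure as an algebra map to the conjugate opposite algebra. -/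
def starHom (n : ℕ) (ω : ℂ) [hn : Fact (1 < n)] [hω : Fact (IsPrimitiveRoot ω n)] :
    RadfordAlgebra n ω →ₐ[ℂ] ConjOpposite n ω :=
  liftHom (ofRadford (g n ω)) (ofRadford (x n ω)) (ofRadford (y n ω))
    (toRadford_injective (by rw [toRadford_pow, toRadford_ofRadford, g_pow, toRadford_one]))
    (toRadford_injective (by rw [toRadford_pow, toRadford_ofRadford, x_pow, toRadford_zero]))
    (toRadford_injective (by rw [toRadford_pow, toRadford_ofRadford, y_pow, toRadford_zero]))
    (toRadford_injective (by
      simp only [toRadford_smul, toRadford_mul, toRadford_ofRadford, conj_omega n, x_mul_g,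
        smul_smul, inv_mul_cancel₀ (omega_ne_zero n (ω := ω)), one_smul]))
    (toRadford_injective (by
      simp only [toRadford_smul, toRadford_mul, toRadford_ofRadford, conj_omega n, g_mul_y,
        smul_smul, inv_mul_cancel₀ (omega_ne_zero n (ω := ω)), one_smul]))
    (toRadford_injective (by
      simp only [toRadford_smul, toRadford_mul, toRadford_ofRadford, conj_omega n, x_mul_y,
        smul_smul, inv_mul_cancel₀ (omega_ne_zero n (ω := ω)), one_smul]))

/-- The standard `*`-structure as a conjugate-linear map. -/
def starLin (n : ℕ) (ω : ℂ) [hn : Fact (1 < n)] [hω : Fact (IsPrimitiveRoot ω n)] :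
    RadfordAlgebra n ω →ₗ⋆[ℂ] RadfordAlgebra n ω where
  toFun h := (starHom n ω h).toRadford
  map_add' u v := by rw [map_add, ConjOpposite.toRadford_add]
  map_smul' r u := by rw [map_smul, ConjOpposite.toRadford_smul]

theorem starLin_mul (u v : RadfordAlgebra n ω) :
    starLin n ω (u * v) = starLin n ω v * starLin n ω u := by
  change (starHom n ω (u * v)).toRadford = _
  rw [map_mul, ConjOpposite.toRadford_mul]
  rfl

theorem starLin_one : starLin n ω 1 = 1 := by
  change (starHom n ω 1).toRadford = _
  rw [map_one, ConjOpposite.toRadford_one]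

theorem starLin_g : starLin n ω (g n ω) = g n ω :=
  congrArg ConjOpposite.toRadford (liftHom_g ..)

theorem starLin_x : starLin n ω (x n ω) = x n ω :=
  congrArg ConjOpposite.toRadford (liftHom_x ..)

theorem starLin_y : starLin n ω (y n ω) = y n ω :=
  congrArg ConjOpposite.toRadford (liftHom_y ..)

theorem map_star_mul (f : RadfordAlgebra n ω →ₗ⋆[ℂ] RadfordAlgebra n ω)
    (hf : ∀ u v, f (u * v) = f v * f u) (s t : RadfordAlgebra n ω ⊗[ℂ] RadfordAlgebra n ω) :
    TensorProduct.map f f (s * t) = TensorProduct.map f f t * TensorProduct.map f f s := by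
  induction s with
  | zero => simp
  | add s₁ s₂ h₁ h₂ => rw [add_mul, map_add, map_add, h₁, h₂, mul_add]
  | tmul a b =>
    induction t with
    | zero => simp
    | add s₁ s₂ h₁ h₂ => rw [mul_add, map_add, map_add, h₁, h₂, add_mul]
    | tmul c d => simp [hf]

theorem starLin_pow (u : RadfordAlgebra n ω) (m : ℕ) :
    starLin n ω (u ^ m) = starLin n ω u ^ m := by
  induction m with
  | zero => simp [starLin_one]
  | succ m ih => rw [pow_succ, starLin_mul, ih, pow_succ']

theorem antipode_g_pow_pred : HopfAlgebra.antipode ℂ (g n ω ^ (n - 1)) = g n ω := by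
  apply (isUnit_g (n := n) (ω := ω) |>.pow (n - 1)).mul_left_injective
  have h := HopfAlgebra.antipode_mul_antidistrib (R := ℂ) (g n ω) (g n ω ^ (n - 1))
  rw [g_mul_pow_pred, antipode_g] at h
  change _ * _ = _ * _
  rw [← h, g_mul_pow_pred]
  exact antipodeLin_one n ω

/-- The standard `*`-structure, which fixes `g`, `x` and `y`. -/
def standardStar (n : ℕ) (ω : ℂ) [hn : Fact (1 < n)] [hω : Fact (IsPrimitiveRoot ω n)] :
    HopfStar (RadfordAlgebra n ω) where
  star := starLin n ω
  star_star h := by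
    induction h using RadfordAlgebra.induction with
    | hg => rw [starLin_g, starLin_g]
    | hx => rw [starLin_x, starLin_x]
    | hy => rw [starLin_y, starLin_y]
    | hc r => simp [Algebra.algebraMap_eq_smul_one, starLin_one]
    | hadd u v hu hv => rw [map_add, map_add, hu, hv]
    | hmul u v hu hv => rw [starLin_mul, starLin_mul, hu, hv]
  star_mul := starLin_mul
  comul_star h := by
    induction h using RadfordAlgebra.induction with
    | hg => simp [starLin_g, comul_g]
    | hx => simp [starLin_x, comul_x, starLin_g, starLin_one]
    | hy => simp [starLin_y, comul_y, starLin_g, starLin_one]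
    | hc r =>
      simp [Algebra.algebraMap_eq_smul_one, starLin_one, Algebra.TensorProduct.one_def]
    | hadd u v hu hv => simp only [map_add, hu, hv]
    | hmul u v hu hv =>
      rw [starLin_mul, Bialgebra.comul_mul, hu, hv, Bialgebra.comul_mul,
        map_star_mul _ starLin_mul]
  antipode_star h := by
    induction h using RadfordAlgebra.induction with
    | hg => rw [starLin_g, antipode_g, starLin_pow, starLin_g, antipode_g_pow_pred]
    | hx =>
      rw [starLin_x, antipode_x, map_neg, starLin_mul, starLin_pow, starLin_g, starLin_x, map_neg,
        HopfAlgebra.antipode_mul_antidistrib, antipode_g_pow_pred, antipode_x, neg_mul, neg_neg,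
        mul_assoc, pow_pred_mul_g, mul_one]
    | hy =>
      rw [starLin_y, antipode_y, map_neg, starLin_mul, starLin_pow, starLin_g, starLin_y, map_neg,
        HopfAlgebra.antipode_mul_antidistrib, antipode_g_pow_pred, antipode_y, neg_mul, neg_neg,
        mul_assoc, pow_pred_mul_g, mul_one]
    | hc r =>
      have h1 : HopfAlgebra.antipode ℂ (1 : RadfordAlgebra n ω) = 1 := antipodeLin_one n ω
      simp [Algebra.algebraMap_eq_smul_one, starLin_one, h1]
    | hadd u v hu hv => simp only [map_add, hu, hv]
    | hmul u v hu hv =>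
      rw [starLin_mul, HopfAlgebra.antipode_mul_antidistrib, starLin_mul,
        HopfAlgebra.antipode_mul_antidistrib, hu, hv]

/-! ### Classification of the `*`-structures -/

theorem star_one (s : HopfStar (RadfordAlgebra n ω)) : s.star 1 = 1 := by
  have h := s.star_mul (s.star 1) 1
  rwa [mul_one, s.star_star, mul_one, eq_comm] at h

theorem star_ext {s t : HopfStar (RadfordAlgebra n ω)} (hg : s.star (g n ω) = t.star (g n ω))
    (hx : s.star (x n ω) = t.star (x n ω)) (hy : s.star (y n ω) = t.star (y n ω)) : s = t := by
  have h : s.star = t.star := by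
    ext u
    induction u using RadfordAlgebra.induction with
    | hg => exact hg
    | hx => exact hx
    | hy => exact hy
    | hc r => simp [Algebra.algebraMap_eq_smul_one, star_one]
    | hadd u v hu hv => rw [map_add, map_add, hu, hv]
    | hmul u v hu hv => rw [s.star_mul, t.star_mul, hu, hv]
  cases s
  cases t
  congr

/-- The only place where `n ≥ 3` is essential: it keeps `x*` from acquiring a `y` component, and
conversely. -/
theorem omega_inv_ne_omega (h3 : 3 ≤ n) : ω⁻¹ ≠ ω := fun h => by
  have h2 : ω ^ 2 = 1 := by
    rw [pow_two]
    nth_rw 1 [← h]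
    exact inv_mul_cancel₀ (omega_ne_zero n)
  exact hω.out.pow_ne_one_of_pos_of_lt two_ne_zero (by omega) h2

theorem conj_mul_self_of_star_eq_smul (s : HopfStar (RadfordAlgebra n ω))
    {z : RadfordAlgebra n ω} (hz : z ≠ 0) {a : ℂ} (h : s.star z = a • z) : conj a * a = 1 := by
  have h1 := s.star_star z
  rw [h, map_smulₛₗ, h, smul_smul] at h1
  have h2 : (conj a * a - 1) • z = 0 := by rw [sub_smul, h1, one_smul, sub_self]
  exact sub_eq_zero.1 ((smul_eq_zero.1 h2).resolve_right hz)

/-- The pair `x*`, `g*` meets the conditions of `groupLike_eq_g`: reversing `x g = ω g x` and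
conjugating `ω` to `ω⁻¹` gives back the same skew-commutation. -/
theorem star_g (s : HopfStar (RadfordAlgebra n ω)) : s.star (g n ω) = g n ω := by
  have hmul : s.star (g n ω) * s.star (g n ω ^ (n - 1)) = 1 := by
    rw [← s.star_mul, pow_pred_mul_g, star_one]
  have hmul' : s.star (g n ω ^ (n - 1)) * s.star (g n ω) = 1 := by
    rw [← s.star_mul, g_mul_pow_pred, star_one]
  have hx := s.comul_star (x n ω)
  have hg := s.comul_star (g n ω)
  refine groupLike_eq_g (X := s.star (x n ω)) ?_ ⟨⟨_, _, hmul, hmul'⟩, rfl⟩ ?_ ?_ ?_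
  · simpa [comul_g] using hg
  · simpa [comul_x, star_one] using hx
  · intro h
    have := s.star_star (x n ω)
    rw [h, map_zero] at this
    exact x_ne_zero this.symm
  · have h := congrArg s.star (x_mul_g n ω)
    rw [s.star_mul, map_smulₛₗ, s.star_mul, conj_omega n] at h
    rw [h, smul_smul, mul_inv_cancel₀ (omega_ne_zero n), one_smul]

theorem exists_star_x (h3 : 3 ≤ n) (s : HopfStar (RadfordAlgebra n ω)) :
    ∃ a : ℂ, s.star (x n ω) = a • x n ω ∧ conj a * a = 1 := by
  have hx := s.comul_star (x n ω)
  obtain ⟨a, b, h1, -, h2⟩ := skewPrimitive_eigenvector (X := s.star (x n ω))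
    (hω.out.ne_one hn.out) (by simpa [comul_x, star_one, star_g] using hx) (by
      have h := congrArg s.star (x_mul_g n ω)
      rw [s.star_mul, map_smulₛₗ, s.star_mul, conj_omega n, star_g] at h
      rw [h, smul_smul, mul_inv_cancel₀ (omega_ne_zero n), one_smul])
  have hb := (mul_eq_zero.1 h2).resolve_right (sub_ne_zero.2 (omega_inv_ne_omega h3))
  rw [hb, zero_smul, add_zero] at h1
  exact ⟨a, h1, conj_mul_self_of_star_eq_smul s x_ne_zero h1⟩

theorem exists_star_y (h3 : 3 ≤ n) (s : HopfStar (RadfordAlgebra n ω)) :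
    ∃ a : ℂ, s.star (y n ω) = a • y n ω ∧ conj a * a = 1 := by
  have hy := s.comul_star (y n ω)
  obtain ⟨a, b, h1, h2, -⟩ := skewPrimitive_eigenvector (X := s.star (y n ω))
    (hω.out.inv.ne_one hn.out) (by simpa [comul_y, star_one, star_g] using hy) (by
      have h := congrArg s.star (g_mul_y n ω)
      rwa [s.star_mul, map_smulₛₗ, s.star_mul, conj_omega n, star_g] at h)
  have ha := (mul_eq_zero.1 h2).resolve_right (sub_ne_zero.2 (omega_inv_ne_omega h3).symm)
  rw [ha, zero_smul, zero_add] at h1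
  exact ⟨b, h1, conj_mul_self_of_star_eq_smul s y_ne_zero h1⟩

/-! ### Rescaling automorphisms and equivalence -/

variable (n ω) in
/-- The algebra endomorphism `g ↦ g`, `x ↦ β x`, `y ↦ γ y`. -/
def scaleHom (β γ : ℂ) : RadfordAlgebra n ω →ₐ[ℂ] RadfordAlgebra n ω :=
  liftHom (g n ω) (β • x n ω) (γ • y n ω) (g_pow n ω) (by rw [smul_pow, x_pow, smul_zero])
    (by rw [smul_pow, y_pow, smul_zero])
    (by rw [smul_mul_assoc, x_mul_g, mul_smul_comm, smul_comm])
    (by rw [mul_smul_comm, g_mul_y, smul_mul_assoc, smul_comm])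
    (by rw [smul_mul_smul_comm, x_mul_y, smul_mul_smul_comm, smul_comm, mul_comm β])

theorem scaleHom_g (β γ : ℂ) : scaleHom n ω β γ (g n ω) = g n ω := liftHom_g ..
theorem scaleHom_x (β γ : ℂ) : scaleHom n ω β γ (x n ω) = β • x n ω := liftHom_x ..
theorem scaleHom_y (β γ : ℂ) : scaleHom n ω β γ (y n ω) = γ • y n ω := liftHom_y ..

theorem scaleHom_comp {β γ β' γ' : ℂ} (hβ : β * β' = 1) (hγ : γ * γ' = 1) :
    (scaleHom n ω β γ).comp (scaleHom n ω β' γ') = AlgHom.id ℂ _ := by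
  apply algHom_ext
  · simp [scaleHom_g]
  · simp [scaleHom_x, smul_smul, mul_comm β', hβ]
  · simp [scaleHom_y, smul_smul, mul_comm γ', hγ]

variable (n ω) in
/-- The Hopf algebra automorphism `g ↦ g`, `x ↦ β x`, `y ↦ γ y`. -/
def scaleEquiv (β γ : ℂ) (hβ : β ≠ 0) (hγ : γ ≠ 0) :
    RadfordAlgebra n ω ≃ₐc[ℂ] RadfordAlgebra n ω :=
  BialgEquiv.ofAlgEquiv
    (AlgEquiv.ofAlgHom (scaleHom n ω β γ) (scaleHom n ω β⁻¹ γ⁻¹)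
      (scaleHom_comp (mul_inv_cancel₀ hβ) (mul_inv_cancel₀ hγ))
      (scaleHom_comp (inv_mul_cancel₀ hβ) (inv_mul_cancel₀ hγ)))
    (by
      apply algHom_ext <;>
        simp [scaleHom_g, scaleHom_x, scaleHom_y, counit_x, counit_y])
    (by
      apply algHom_ext <;>
        simp [scaleHom_g, scaleHom_x, scaleHom_y, comul_g, comul_x, comul_y,
          TensorProduct.smul_tmul'])

theorem scaleEquiv_apply (β γ : ℂ) (hβ : β ≠ 0) (hγ : γ ≠ 0) (u : RadfordAlgebra n ω) :
    scaleEquiv n ω β γ hβ hγ u = scaleHom n ω β γ u := rfl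

theorem scaleHom_antipode (β γ : ℂ) (u : RadfordAlgebra n ω) :
    scaleHom n ω β γ (HopfAlgebra.antipode ℂ u)
      = HopfAlgebra.antipode ℂ (scaleHom n ω β γ u) := by
  induction u using RadfordAlgebra.induction with
  | hg => rw [scaleHom_g, antipode_g, map_pow, scaleHom_g]
  | hx => simp [antipode_x, scaleHom_g, scaleHom_x]
  | hy => simp [antipode_y, scaleHom_g, scaleHom_y]
  | hc r =>
    have h1 : HopfAlgebra.antipode ℂ (1 : RadfordAlgebra n ω) = 1 := antipodeLin_one n ω
    simp [Algebra.algebraMap_eq_smul_one, h1]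
  | hadd u v hu hv => simp only [map_add, hu, hv]
  | hmul u v hu hv =>
    rw [HopfAlgebra.antipode_mul_antidistrib, map_mul, hu, hv, map_mul,
      HopfAlgebra.antipode_mul_antidistrib]

/-- For `x* = a x` and `x*' = b x`, the equation on `β` says exactly that `x ↦ β x` intertwines the
two. A square root of `conj a * b` works, since it has modulus one. -/
theorem exists_conj_scale {a b : ℂ} (ha : conj a * a = 1) (hb : conj b * b = 1) :
    ∃ β : ℂ, β ≠ 0 ∧ a * β = conj β * b := by
  have hb0 : b ≠ 0 := fun h => by simp [h] at hb
  have hca0 : conj a ≠ 0 := fun h => by simp [h] at ha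
  obtain ⟨β, hβ⟩ := IsAlgClosed.exists_pow_nat_eq (conj a * b) two_pos
  have hβ0 : β ≠ 0 := fun h => by
    rw [h, zero_pow two_ne_zero] at hβ
    exact mul_ne_zero hca0 hb0 hβ.symm
  have h1 : (conj β * β) ^ 2 = 1 := by
    rw [mul_pow, ← map_pow, hβ, map_mul, Complex.conj_conj]
    linear_combination b * conj b * ha + hb
  have h2 : conj β * β = 1 := by
    rw [← Complex.normSq_eq_conj_mul_self] at h1 ⊢
    norm_cast at h1 ⊢
    exact (pow_eq_one_iff_of_nonneg (Complex.normSq_nonneg β) two_ne_zero).1 h1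
  -- After multiplication by `β`, both sides equal `b`: `a β ^ 2 = a (conj a) b` and `conj β * β =
  -- 1`.
  refine ⟨β, hβ0, mul_right_cancel₀ hβ0 ?_⟩
  linear_combination a * hβ + b * ha - b * h2

theorem equivalent (h3 : 3 ≤ n) (s t : HopfStar (RadfordAlgebra n ω)) : s.Equivalent t := by
  obtain ⟨a, hsx, ha⟩ := exists_star_x h3 s
  obtain ⟨b, hsy, hb⟩ := exists_star_y h3 s
  obtain ⟨c, htx, hc⟩ := exists_star_x h3 t
  obtain ⟨d, hty, hd⟩ := exists_star_y h3 t
  obtain ⟨β, hβ, h1⟩ := exists_conj_scale ha hc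
  obtain ⟨γ, hγ, h2⟩ := exists_conj_scale hb hd
  refine ⟨scaleEquiv n ω β γ hβ hγ, fun h => scaleHom_antipode β γ h, fun h => ?_⟩
  rw [scaleEquiv_apply, scaleEquiv_apply]
  induction h using RadfordAlgebra.induction with
  | hg => rw [star_g, scaleHom_g, star_g]
  | hx => rw [hsx, map_smul, scaleHom_x, map_smulₛₗ, htx, smul_smul, smul_smul, h1]
  | hy => rw [hsy, map_smul, scaleHom_y, map_smulₛₗ, hty, smul_smul, smul_smul, h2]
  | hc r => simp [Algebra.algebraMap_eq_smul_one, star_one]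
  | hadd u v hu hv => simp only [map_add, hu, hv]
  | hmul u v hu hv => rw [s.star_mul, map_mul, hu, hv, map_mul, t.star_mul]

end

end

end RadfordAlgebra

theorem theorem3p8 (n : ℕ) (ω : ℂ) [Fact (1 < n)] [Fact (IsPrimitiveRoot ω n)] (hn : 3 ≤ n) :
    ∃ s₀ : HopfStar (RadfordAlgebra n ω),
      (s₀.star (RadfordAlgebra.g n ω) = RadfordAlgebra.g n ω ∧
        s₀.star (RadfordAlgebra.x n ω) = RadfordAlgebra.x n ω ∧
        s₀.star (RadfordAlgebra.y n ω) = RadfordAlgebra.y n ω) ∧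
      (∀ s : HopfStar (RadfordAlgebra n ω),
        s.star (RadfordAlgebra.g n ω) = RadfordAlgebra.g n ω →
        s.star (RadfordAlgebra.x n ω) = RadfordAlgebra.x n ω →
        s.star (RadfordAlgebra.y n ω) = RadfordAlgebra.y n ω → s = s₀) ∧
      (∀ s s' : HopfStar (RadfordAlgebra n ω), s.Equivalent s') :=
  ⟨RadfordAlgebra.standardStar n ω,
    ⟨RadfordAlgebra.starLin_g, RadfordAlgebra.starLin_x, RadfordAlgebra.starLin_y⟩,
    fun _ hg hx hy => RadfordAlgebra.star_ext (hg.trans RadfordAlgebra.starLin_g.symm)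
      (hx.trans RadfordAlgebra.starLin_x.symm) (hy.trans RadfordAlgebra.starLin_y.symm),
    RadfordAlgebra.equivalent hn⟩
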